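/- Let $G$ be a finite simple graph with vertex set $\{t_1,\ldots,t_s\}$ (no loops or multiple edges; isolated vertices are allowed and $G$ need not be connected), let $K$ be a field and let $S=K[t_1,\ldots,t_s]$. For an edge $e$ of $G$ put $t_e=\prod_{t_i\in e}t_i$ and let $v_e\in\{0,1\}^s$ be the exponent vector of $t_e$. Let $I\subset S$ be the edge ideal of $G$, generated by the monomials $t_e$ with $e$ an edge of $G$, and let $I^*\subset S$ be its dual, generated by the monomials $t_1\cdots t_s/t_e$ with $e$ an edge of $G$. An ideal $J$ of $S$ is called normal if $J^n$ equals its integral closure $\overline{J^n}$ for all $n\ge 1$, where the integral closure of an ideal $L$ is the set of all $x\in S$ that satisfy an equation $x^m+a_1x^{m-1}+\cdots+a_m=0$ with $m\ge 1$ and $a_i\in L^i$ for $i=1,\ldots,m$. Let $e_1,\ldots,e_{s+1}$ be the unit vectors of $\mathbb{R}^{s+1}$ and let $$\mathcal{B}=\{e_{s+1}\}\cup\{e_i+e_{s+1}\mid 1\le i\le s\}\cup\{(v_e,1)\mid e \text{ an edge of } G\}\subset\mathbb{R}^{s+1}.$$ A finite set $\mathcal{H}\subset\mathbb{R}^{d}$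 is called a Hilbert basis if $\mathbb{Z}^{d}\cap\mathbb{R}_+\mathcal{H}=\mathbb{N}\mathcal{H}$, where $\mathbb{R}_+\mathcal{H}$ is the cone of all linear combinations of $\mathcal{H}$ with nonnegative real coefficients and $\mathbb{N}\mathcal{H}$ is the set of all linear combinations of $\mathcal{H}$ with coefficients in $\mathbb{N}=\{0,1,2,\ldots\}$. Then the following hold. 1. $I^*$ is normal if and only if $I$ is normal. 2. $I^*$ is normal if and only if $\mathcal{B}$ is a Hilbert basis. -/

import Mathlib

noncomputable section

namespace EdgeIdealDuality

open scoped Classical in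
/-- The squarefree monomial `t_e`, the product of the variables `t_i` with `i ∈ e`. -/
def edgeMonomial (K : Type*) [Field K] {V : Type*} [Fintype V] (e : Sym2 V) :
    MvPolynomial V K :=
  ∏ i ∈ Finset.univ.filter (fun i => i ∈ e), MvPolynomial.X i

open scoped Classical in
/-- The monomial `t_1 ⋯ t_s / t_e`, the product of the variables `t_i` with `i ∉ e`. -/
def coedgeMonomial (K : Type*) [Field K] {V : Type*} [Fintype V] (e : Sym2 V) :
    MvPolynomial V K :=
  ∏ i ∈ Finset.univ.filter (fun i => i ∉ e), MvPolynomial.X i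

/-- `coedgeMonomial` is the quotient of the product of all the variables by `t_e`. -/
theorem edgeMonomial_mul_coedgeMonomial (K : Type*) [Field K] {V : Type*} [Fintype V]
    (e : Sym2 V) :
    edgeMonomial K e * coedgeMonomial K e = ∏ i : V, (MvPolynomial.X i : MvPolynomial V K) := by
  classical
  unfold edgeMonomial coedgeMonomial
  convert Finset.prod_filter_mul_prod_filter_not Finset.univ (fun i => i ∈ e)
    (fun i => (MvPolynomial.X i : MvPolynomial V K))

/-- The edge ideal `I(G)` of a graph `G`, in the polynomial ring over `K` whose variables are the
vertices of `G`. -/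
def edgeIdeal (K : Type*) [Field K] {V : Type*} [Fintype V] (G : SimpleGraph V) :
    Ideal (MvPolynomial V K) :=
  Ideal.span {f | ∃ e ∈ G.edgeSet, f = edgeMonomial K e}

/-- The dual `I*` of the edge ideal of `G`, generated by the monomials `t_1 ⋯ t_s / t_e` with `e`
an edge of `G`. -/
def dualEdgeIdeal (K : Type*) [Field K] {V : Type*} [Fintype V] (G : SimpleGraph V) :
    Ideal (MvPolynomial V K) :=
  Ideal.span {f | ∃ e ∈ G.edgeSet, f = coedgeMonomial K e}

/-- The integral closure of an ideal `J`: all `x` that satisfy an equation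
`x ^ m + a_1 x ^ (m - 1) + ⋯ + a_m = 0` with `m ≥ 1` and `a_i ∈ J ^ i` for `i = 1, …, m`. -/
def idealIntegralClosure {R : Type*} [CommRing R] (J : Ideal R) : Set R :=
  {x | ∃ m : ℕ, 1 ≤ m ∧ ∃ a : ℕ → R, (∀ i ∈ Finset.Icc 1 m, a i ∈ J ^ i) ∧
    x ^ m + ∑ i ∈ Finset.Icc 1 m, a i * x ^ (m - i) = 0}

/-- An ideal is normal if all its powers `I ^ n`, `n ≥ 1`, are integrally closed. -/
def IsNormalIdeal {R : Type*} [CommRing R] (I : Ideal R) : Prop :=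
  ∀ n : ℕ, 1 ≤ n → idealIntegralClosure (I ^ n) = ((I ^ n : Ideal R) : Set R)

/-- A finite set `B` of real vectors is a Hilbert basis if the integral points of the cone
generated by `B` are exactly the elements of the semigroup (with `0`) spanned by `B`. -/
def IsHilbertBasisSet {ι : Type*} (B : Set (ι → ℝ)) : Prop :=
  B.Finite ∧
    {x : ι → ℝ | ∀ i, ∃ k : ℤ, x i = k} ∩ (PointedCone.hull ℝ B : Set (ι → ℝ)) =
      (AddSubmonoid.closure B : Set (ι → ℝ))

/-- The vector `(v, 1)`; the last coordinate has the index `none`. -/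
def appendOne {V : Type*} (v : V → ℝ) : Option V → ℝ :=
  fun o => o.elim 1 v

/-- The characteristic vector of an edge. -/
def edgeVector {V : Type*} (e : Sym2 V) : V → ℝ :=
  Set.indicator {i | i ∈ e} 1

open scoped Classical in
/-- The set `{(0, 1)} ∪ {(e_i, 1)} ∪ {(v_e, 1)}`, where `i` runs over the vertices of `G` and `v_e`
is the characteristic vector of the edge `e` of `G`. -/
def graphVectors {V : Type*} (G : SimpleGraph V) : Set (Option V → ℝ) :=
  {appendOne 0} ∪ Set.range (fun i : V => appendOne (Pi.single i 1)) ∪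
    (fun e : Sym2 V => appendOne (edgeVector e)) '' G.edgeSet

end EdgeIdealDuality

end

/-!
All three properties are instances of one comparison between real and integral linear
combinations of the edge vectors `v_e`, and Gallai's theorem on matchings and edge covers
translates them into each other.

For a monomial ideal with exponent vectors `v_i`, normality says that an integral vector `a` which
dominates a real nonnegative combination of the `v_i` with coefficient sum `n` also dominates an
integral one (`isNormalIdeal_monomialIdeal_iff`). If `a` dominates a real combination, simultaneous
Diophantine approximation gives a multiple `N a` that dominates an integral one, so the monomial
`x^a` satisfies an equation of integral dependence of the form `x^N - c = 0`. Conversely, an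
exponent of an integral element that dominates no real combination would be separated from those
that do by a linear weight, and the terms of least weight in the equation of integral dependence
could not cancel (`integral_equation_false_of_weight`).

Let `b` be an integral vector, and call nonnegative coefficients `c_e` with `∑ c_e v_e ≤ b` a
`b`-matching of size `∑ c_e`; it may be real or integral. Normality of `I`
says that a real `b`-matching of size `k` can always be replaced by an integral one. Writing
`(b, n)` as a combination of the vectors in `graphVectors G` amounts to giving a `b`-matching of
size at least `|b| - n`, as the coefficients of the other vectors are then determined; so the
Hilbert basis property says the same thing (`isHilbertBasisSet_graphVectors_iff`). Finally, an
exponent `a` dominates a combination of the vectors `1 - v_e` with coefficient sum `n` exactly if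
`n - a` is covered by the corresponding combination of the `v_e`. By Gallai's theorem, which has
one proof for real and integral coefficients (`hasMatching_iff_covers`), edge covers of `b` of
weight `n` and `b`-matchings of size at least `|b| - n` come together if `b` vanishes at isolated
vertices, and the latter can be assumed (`hasMatching_congr_support`). So normality of the dual
ideal is again the same property.
-/

namespace EdgeIdealDuality

open Finset
open scoped Pointwise

/-! ### Packings, coverings and matchings -/

/-- Over `R = ℤ` or `R = ℝ`: `a` dominates a nonnegative combination of the vectors `v i` whose
coefficients have sum `n`. -/
def Packs (R : Type*) [CommRing R] [LinearOrder R] {ι V : Type*} [Fintype ι]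
    (v : ι → V → ℕ) (a : V → ℕ) (n : ℕ) : Prop :=
  ∃ c : ι → R, (∀ i, 0 ≤ c i) ∧ ∑ i, c i = n ∧ ∀ x, ∑ i, c i * v i x ≤ a x

/-- Over `R = ℤ` or `R = ℝ`: `b` is dominated by a nonnegative combination of the vectors `v i`
whose coefficients have sum `n`. -/
def Covers (R : Type*) [CommRing R] [LinearOrder R] {ι V : Type*} [Fintype ι]
    (v : ι → V → ℕ) (b : V → ℕ) (n : ℕ) : Prop :=
  ∃ c : ι → R, (∀ i, 0 ≤ c i) ∧ ∑ i, c i = n ∧ ∀ x, (b x : R) ≤ ∑ i, c i * v i x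

/-- Over `R = ℤ` or `R = ℝ`: there is a `b`-matching, integral or fractional, of size at
least `|b| - n`, where `|b|` is the sum of the entries of `b`. -/
def HasMatching (R : Type*) [CommRing R] [LinearOrder R] {ι V : Type*} [Fintype ι] [Fintype V]
    (v : ι → V → ℕ) (b : V → ℕ) (n : ℕ) : Prop :=
  ∃ c : ι → R, (∀ i, 0 ≤ c i) ∧ (∀ x, ∑ i, c i * v i x ≤ b x) ∧ ∑ x, (b x : R) ≤ n + ∑ i, c i

open scoped Classical in
/-- The exponent vector of the monomial `t_e`. -/
noncomputable def edgeExponent {V : Type*} (e : Sym2 V) (x : V) : ℕ := if x ∈ e then 1 else 0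

/-! ### Gallai's theorem -/

section Ordered

variable {R : Type*} [CommRing R] [LinearOrder R] [IsStrictOrderedRing R]

/-- A nonnegative family can be decreased so that its sum takes any prescribed smaller value. -/
theorem exists_le_sum_eq {ι : Type*} (S : Finset ι) (c : ι → R) (hc : ∀ i, 0 ≤ c i) :
    ∀ k : R, 0 ≤ k → k ≤ ∑ i ∈ S, c i →
      ∃ d : ι → R, (∀ i, 0 ≤ d i) ∧ (∀ i, d i ≤ c i) ∧ ∑ i ∈ S, d i = k := by
  classical
  induction S using Finset.induction_on with
  | empty =>
    intro k hk hk'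
    exact ⟨c, hc, fun _ => le_rfl, by simp at hk' ⊢; exact le_antisymm hk hk'⟩
  | insert j S hj ih =>
    intro k hk hkS
    rw [sum_insert hj] at hkS
    have key : ∀ (d : ι → R) (t : R), ∑ i ∈ insert j S, Function.update d j t i
        = t + ∑ i ∈ S, d i := by
      intro d t
      rw [sum_insert hj, Function.update_self]
      congr 1
      exact sum_congr rfl fun i hi => Function.update_of_ne (by rintro rfl; exact hj hi) _ _
    rcases le_total k (∑ i ∈ S, c i) with h | h
    · obtain ⟨d, hd, hdc, hs⟩ := ih k hk h
      refine ⟨Function.update d j 0, fun i => ?_, fun i => ?_, by rw [key, hs, zero_add]⟩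
      all_goals rcases eq_or_ne i j with rfl | hij <;> simp_all
    · refine ⟨Function.update c j (k - ∑ i ∈ S, c i), fun i => ?_, fun i => ?_, by rw [key]; ring⟩
      · rcases eq_or_ne i j with rfl | hij <;> simp_all
      · rcases eq_or_ne i j with rfl | hij
        · simp; linarith
        · simp_all

/-- A matching of size at least `k` may be trimmed to size exactly `k`. -/
theorem packs_iff_hasMatching {ι V : Type*} [Fintype ι] [Fintype V]
    (v : ι → V → ℕ) (b : V → ℕ) (k n : ℕ) (h : n + k = ∑ x, b x) :
    Packs R v b k ↔ HasMatching R v b n := by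
  have h' : (n : R) + k = ∑ x, (b x : R) := by exact_mod_cast congrArg (Nat.cast (R := R)) h
  constructor
  · rintro ⟨c, hc, hs, hb⟩
    exact ⟨c, hc, hb, by rw [hs, h']⟩
  · rintro ⟨c, hc, hb, hs⟩
    obtain ⟨d, hd, hdc, hdk⟩ := exists_le_sum_eq univ c hc k (Nat.cast_nonneg k) (by linarith)
    refine ⟨d, hd, hdk, fun x => le_trans (sum_le_sum fun i _ => ?_) (hb x)⟩
    exact mul_le_mul_of_nonneg_right (hdc i) (Nat.cast_nonneg _)

theorem sum_mul_edgeExponent {V : Type*} [Fintype V] (e : Sym2 V) (he : ¬ e.IsDiag) (f : V → R) :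
    ∃ x y : V, e = s(x, y) ∧ ∑ z, f z * edgeExponent e z = f x + f y := by
  classical
  induction e with
  | _ x y =>
    refine ⟨x, y, rfl, ?_⟩
    have hxy : x ≠ y := by simpa using he
    have : ∀ z, f z * (edgeExponent s(x, y) z : R) =
        (if z = x then f z else 0) + (if z = y then f z else 0) := by
      intro z
      unfold edgeExponent
      by_cases h1 : z = x
      · subst h1; simp [hxy]
      · by_cases h2 : z = y <;> simp [h1, h2, hxy.symm]
    simp [this, sum_add_distrib]

theorem sum_edgeExponent {V : Type*} [Fintype V] (e : Sym2 V) (he : ¬ e.IsDiag) :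
    ∑ z, (edgeExponent e z : R) = 2 := by
  obtain ⟨x, y, -, h⟩ := sum_mul_edgeExponent (R := R) e he (fun _ => 1)
  simp only [one_mul] at h
  rw [h]; norm_num

theorem sum_sum_mul_edgeExponent {ι V : Type*} [Fintype ι] [Fintype V] (e : ι → Sym2 V)
    (he : ∀ i, ¬ (e i).IsDiag) (c : ι → R) :
    ∑ x, ∑ i, c i * (edgeExponent (e i) x : R) = 2 * ∑ i, c i := by
  rw [sum_comm, mul_sum]
  refine sum_congr rfl fun i _ => ?_
  rw [← mul_sum, sum_edgeExponent _ (he i), mul_comm]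

/-- The half of Gallai's theorem that turns an edge cover of weight `n` into a matching of size at
least `|b| - n`. The edges of the cover are treated one at a time: an edge `{x, y}` of weight `c`
accounts for `p = min (b x) c` at `x` and `q = min (b y) c` at `y`, and it enters the matching with
weight `min p q`; what counts is `p + q = max p q + min p q ≤ c + min p q`. -/
theorem exists_matching_of_cover {ι V : Type*} [Fintype V] (e : ι → Sym2 V)
    (he : ∀ i, ¬ (e i).IsDiag) (c : ι → R) (hc : ∀ i, 0 ≤ c i) (S : Finset ι) :
    ∀ b : V → R, (∀ x, 0 ≤ b x) → (∀ x, b x ≤ ∑ i ∈ S, c i * edgeExponent (e i) x) →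
      ∃ d : ι → R, (∀ i, 0 ≤ d i) ∧ (∀ x, ∑ i ∈ S, d i * edgeExponent (e i) x ≤ b x) ∧
        ∑ x, b x ≤ ∑ i ∈ S, c i + ∑ i ∈ S, d i := by
  classical
  induction S using Finset.induction_on with
  | empty =>
    intro b hb hb'
    refine ⟨c, hc, by simpa using hb, ?_⟩
    simpa using sum_nonpos fun x _ => by simpa using hb' x
  | insert j S hj ih =>
    intro b hb hbS
    obtain ⟨x, y, hxy, hsum⟩ := sum_mul_edgeExponent (e j) (he j) (fun z => min (b z) (c j))
    obtain ⟨d, hd, hdb, hds⟩ := ih (fun z => b z - min (b z) (c j) * edgeExponent (e j) z)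
      (fun z => by
        unfold edgeExponent
        split_ifs
        · simp
        · simpa using hb z)
      (fun z => by
        have h1 := hbS z
        rw [sum_insert hj] at h1
        have h2 : 0 ≤ ∑ i ∈ S, c i * (edgeExponent (e i) z : R) :=
          sum_nonneg fun i _ => mul_nonneg (hc i) (Nat.cast_nonneg _)
        by_cases hz : z ∈ e j
        · have : edgeExponent (e j) z = 1 := if_pos hz
          simp only [this, Nat.cast_one, mul_one] at h1 ⊢
          rcases min_cases (b z) (c j) with h | h <;> linarith
        · have : edgeExponent (e j) z = 0 := if_neg hz
          simp only [this, Nat.cast_zero, mul_zero] at h1 ⊢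
          linarith)
    set t := min (min (b x) (c j)) (min (b y) (c j)) with ht
    have ht0 : 0 ≤ t := le_min (le_min (hb x) (hc j)) (le_min (hb y) (hc j))
    have hne : ∀ i ∈ S, i ≠ j := by rintro i hi rfl; exact hj hi
    have hupd : ∀ i ∈ S, Function.update d j t i = d i :=
      fun i hi => Function.update_of_ne (hne i hi) _ _
    refine ⟨Function.update d j t, fun i => ?_, fun z => ?_, ?_⟩
    · rcases eq_or_ne i j with rfl | hij
      · simpa using ht0
      · simpa [hij] using hd i
    · rw [sum_insert hj, Function.update_self, sum_congr rfl fun i hi => by rw [hupd i hi]]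
      have h1 := hdb z
      have h2 : t * (edgeExponent (e j) z : R) ≤ min (b z) (c j) * edgeExponent (e j) z := by
        by_cases hz : z ∈ e j
        · refine mul_le_mul_of_nonneg_right ?_ (Nat.cast_nonneg _)
          rw [hxy, Sym2.mem_iff] at hz
          rcases hz with rfl | rfl
          · exact min_le_left _ _
          · exact min_le_right _ _
        · have : edgeExponent (e j) z = 0 := if_neg hz
          simp [this]
      linarith
    · rw [sum_insert hj, sum_insert hj, Function.update_self, sum_congr rfl hupd]
      rw [sum_sub_distrib, hsum] at hds
      have h3 : min (b x) (c j) + min (b y) (c j) ≤ c j + t := by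
        have := min_le_right (b x) (c j)
        have := min_le_right (b y) (c j)
        rw [ht]
        rcases min_cases (min (b x) (c j)) (min (b y) (c j)) with h | h <;> linarith
      linarith

/-- Gallai's theorem, for integral and fractional `b`-matchings alike: if `b` vanishes at isolated
vertices, `b`-matchings of size at least `|b| - n` and edge covers of `b` of weight `n` come
together. -/
theorem hasMatching_iff_covers {ι V : Type*} [Fintype ι] [Nonempty ι] [Fintype V] (e : ι → Sym2 V)
    (he : ∀ i, ¬ (e i).IsDiag) (b : V → ℕ) (hb : ∀ x, b x ≠ 0 → ∃ i, x ∈ e i) (n : ℕ) :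
    HasMatching R (fun i => edgeExponent (e i)) b n ↔
      Covers R (fun i => edgeExponent (e i)) b n := by
  classical
  constructor
  · rintro ⟨c, hc, hcb, hs⟩
    have hch : ∀ x, ∃ i, b x ≠ 0 → x ∈ e i := fun x => by
      by_cases hx : b x = 0
      · exact ⟨Classical.arbitrary ι, fun h => absurd hx h⟩
      · obtain ⟨i, hi⟩ := hb x hx
        exact ⟨i, fun _ => hi⟩
    choose g hg using hch
    -- The part of `b` that the matching leaves uncovered is covered vertex by vertex.
    set r : V → R := fun x => b x - ∑ i, c i * edgeExponent (e i) x with hr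
    have hr0 : ∀ x, 0 ≤ r x := fun x => sub_nonneg.2 (hcb x)
    have hrs : ∑ x, r x = ∑ x, (b x : R) - 2 * ∑ i, c i := by
      rw [hr, sum_sub_distrib, sum_sum_mul_edgeExponent e he]
    set u : R := n - ∑ i, c i - ∑ x, r x with hu
    have hu0 : 0 ≤ u := by rw [hu, hrs]; linarith
    set i₀ : ι := Classical.arbitrary ι
    have h1 : ∀ i, 0 ≤ ∑ x, if g x = i then r x else 0 := fun i =>
      sum_nonneg fun x _ => by split_ifs; exacts [hr0 x, le_rfl]
    have h2 : ∀ i, 0 ≤ if i = i₀ then u else 0 := fun i => by split_ifs; exacts [hu0, le_rfl]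
    refine ⟨fun i => c i + (∑ x, if g x = i then r x else 0) + if i = i₀ then u else 0,
      fun i => add_nonneg (add_nonneg (hc i) (h1 i)) (h2 i), ?_, fun x => ?_⟩
    · rw [sum_add_distrib, sum_add_distrib, sum_comm]
      simp [hu]
    · have h3 : r x ≤ ∑ i, (∑ y, if g y = i then r y else 0) * (edgeExponent (e i) x : R) := by
        by_cases hx : b x = 0
        · refine le_trans ?_ (sum_nonneg fun i _ => mul_nonneg (h1 i) (Nat.cast_nonneg _))
          simp only [hr, hx, Nat.cast_zero, zero_sub, Left.neg_nonpos_iff]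
          exact sum_nonneg fun i _ => mul_nonneg (hc i) (Nat.cast_nonneg _)
        · refine le_trans ?_ (single_le_sum (f := fun i => (∑ y, if g y = i then r y else 0) *
            (edgeExponent (e i) x : R)) (fun i _ => mul_nonneg (h1 i) (Nat.cast_nonneg _))
            (mem_univ (g x)))
          have : edgeExponent (e (g x)) x = 1 := if_pos (hg x hx)
          simp only [this, Nat.cast_one, mul_one]
          refine le_trans ?_ (single_le_sum (f := fun y => if g y = g x then r y else 0)
            (fun y _ => by split_ifs; exacts [hr0 y, le_rfl]) (mem_univ x))
          simp
      have h4 : 0 ≤ ∑ i, (if i = i₀ then u else 0) * (edgeExponent (e i) x : R) :=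
        sum_nonneg fun i _ => mul_nonneg (h2 i) (Nat.cast_nonneg _)
      simp only [add_mul, sum_add_distrib]
      have h5 : (b x : R) = r x + ∑ i, c i * edgeExponent (e i) x := by rw [hr]; ring
      linarith
  · rintro ⟨c, hc, hs, hcb⟩
    obtain ⟨d, hd, hdb, hds⟩ := exists_matching_of_cover e he c hc univ (fun x => (b x : R))
      (fun x => Nat.cast_nonneg _) hcb
    exact ⟨d, hd, hdb, by rw [← hs]; exact hds⟩

/-- An isolated vertex contributes `b x` to `|b|` and nothing to the matching. -/
theorem hasMatching_congr_support {ι V : Type*} [Fintype ι] [Fintype V] (e : ι → Sym2 V)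
    (b b' : V → ℕ) (n n' s : ℕ) (hn : n = n' + s) (hs : ∑ x, b x = ∑ x, b' x + s)
    (h : ∀ x, (∃ i, x ∈ e i) → b x = b' x) :
    HasMatching R (fun i => edgeExponent (e i)) b n ↔
      HasMatching R (fun i => edgeExponent (e i)) b' n' := by
  have hs' : ∑ x, (b x : R) = ∑ x, (b' x : R) + s := by
    exact_mod_cast congrArg (Nat.cast (R := R)) hs
  subst hn
  refine exists_congr fun c => and_congr_right fun hc => and_congr (forall_congr' fun x => ?_) ?_
  · by_cases hx : ∃ i, x ∈ e i
    · rw [h x hx]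
    · have : ∀ i, edgeExponent (e i) x = 0 := fun i => if_neg fun hi => hx ⟨i, hi⟩
      simp [this]
  · rw [hs']
    push_cast
    constructor <;> intro h <;> linarith

/-- Since `n` is the sum of the coefficients, `∑ c_i (1 - v_i) ≤ a` means `n - a ≤ ∑ c_i v_i`. The
truncation of `n - a x` at `0` is harmless because the right-hand side is nonnegative. -/
theorem packs_compl_iff_covers {ι V : Type*} [Fintype ι] (v : ι → V → ℕ) (hv : ∀ i x, v i x ≤ 1)
    (a b : V → ℕ) (n : ℕ) (hab : ∀ x, b x = n - a x) :
    Packs R (fun i x => 1 - v i x) a n ↔ Covers R v b n := by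
  refine exists_congr fun c => and_congr_right fun hc => and_congr_right fun hs =>
    forall_congr' fun x => ?_
  have h1 : ∑ i, c i * ((1 - v i x : ℕ) : R) = n - ∑ i, c i * (v i x : R) := by
    rw [← hs, ← sum_sub_distrib]
    exact sum_congr rfl fun i _ => by rw [Nat.cast_sub (hv i x)]; push_cast; ring
  have h2 : 0 ≤ ∑ i, c i * (v i x : R) :=
    sum_nonneg fun i _ => mul_nonneg (hc i) (Nat.cast_nonneg _)
  rw [h1, hab]
  rcases le_total n (a x) with h | h
  · have h' : (n : R) ≤ a x := by exact_mod_cast h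
    rw [Nat.sub_eq_zero_of_le h, Nat.cast_zero]
    constructor <;> intro _ <;> linarith
  · rw [Nat.cast_sub h]
    constructor <;> intro _ <;> linarith

end Ordered

/-! ### Integer rounding of matchings -/

section Comparison

variable {ι V : Type*} [Fintype ι] [Fintype V]

/-- Integer rounding for the generators of the edge ideal. For `|b| ≤ n` the empty matching serves;
otherwise a matching of size at least `|b| - n` can be trimmed to size `|b| - n`. -/
theorem packs_int_iff_matching_int (e : ι → Sym2 V) (he : ∀ i, ¬ (e i).IsDiag) :
    (∀ n : ℕ, 1 ≤ n → ∀ a : V → ℕ, Packs ℝ (fun i => edgeExponent (e i)) a n →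
      Packs ℤ (fun i => edgeExponent (e i)) a n) ↔
    ∀ (b : V → ℕ) (n : ℕ), HasMatching ℝ (fun i => edgeExponent (e i)) b n →
      HasMatching ℤ (fun i => edgeExponent (e i)) b n := by
  constructor
  · intro H b n h
    rcases le_or_gt (∑ x, b x) n with hn | hn
    · refine ⟨0, fun _ => le_rfl, by simp, ?_⟩
      simpa using (by exact_mod_cast hn : ∑ x, (b x : ℤ) ≤ n)
    · have hk : n + (∑ x, b x - n) = ∑ x, b x := by omega
      rw [← packs_iff_hasMatching _ _ _ _ hk] at h ⊢
      exact H _ (by omega) _ h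
  · intro H k _ a h
    have hk : k ≤ ∑ x, a x := by
      obtain ⟨c, hc, hs, ha⟩ := h
      have h1 := sum_le_sum fun x (_ : x ∈ univ) => ha x
      rw [sum_sum_mul_edgeExponent e he, hs] at h1
      have h2 : 2 * k ≤ ∑ x, a x := by exact_mod_cast h1
      omega
    have hn : (∑ x, a x - k) + k = ∑ x, a x := by omega
    rw [packs_iff_hasMatching _ _ _ _ hn] at h ⊢
    exact H _ _ h

/-- Integer rounding for the generators of the dual ideal: complementation turns packings into
coverings, and Gallai's theorem turns these into matchings once the isolated vertices have been
stripped from `b`. -/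
theorem packs_compl_int_iff_matching_int (e : ι → Sym2 V) (he : ∀ i, ¬ (e i).IsDiag) :
    (∀ n : ℕ, 1 ≤ n → ∀ a : V → ℕ, Packs ℝ (fun i x => 1 - edgeExponent (e i) x) a n →
      Packs ℤ (fun i x => 1 - edgeExponent (e i) x) a n) ↔
    ∀ (b : V → ℕ) (n : ℕ), HasMatching ℝ (fun i => edgeExponent (e i)) b n →
      HasMatching ℤ (fun i => edgeExponent (e i)) b n := by
  classical
  have hv : ∀ i x, edgeExponent (e i) x ≤ 1 := fun i x => by unfold edgeExponent; split_ifs <;> simp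
  rcases isEmpty_or_nonempty ι with hι | hι
  · refine iff_of_true ?_ ?_
    · rintro n hn a ⟨c, -, hs, -⟩
      rw [univ_eq_empty, sum_empty] at hs
      have : n = 0 := by exact_mod_cast hs.symm
      omega
    · rintro b n ⟨c, -, -, hs⟩
      refine ⟨0, fun _ => le_rfl, by simp, ?_⟩
      rw [univ_eq_empty (α := ι), sum_empty, add_zero] at hs ⊢
      exact_mod_cast hs
  constructor
  · intro H b n h
    set b' : V → ℕ := fun x => if ∃ i, x ∈ e i then b x else 0 with hb'
    set s : ℕ := ∑ x, if ∃ i, x ∈ e i then 0 else b x with hs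
    have hbs : ∑ x, b x = ∑ x, b' x + s := by
      rw [hb', hs, ← sum_add_distrib]
      exact sum_congr rfl fun x _ => by split_ifs <;> simp
    have hsn : s ≤ n := by
      obtain ⟨c, hc, hcb, hcs⟩ := h
      -- The uncovered part of `b` contains `b x` for every isolated vertex `x`.
      have h1 : (s : ℝ) ≤ ∑ x, ((b x : ℝ) - ∑ i, c i * edgeExponent (e i) x) := by
        rw [hs, Nat.cast_sum]
        refine sum_le_sum fun x _ => ?_
        split_ifs with hx
        · simpa using hcb x
        · have : ∀ i, edgeExponent (e i) x = 0 := fun i => if_neg fun hi => hx ⟨i, hi⟩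
          simp [this]
      rw [sum_sub_distrib, sum_sum_mul_edgeExponent e he] at h1
      have h2 : 0 ≤ ∑ i, c i := sum_nonneg fun i _ => hc i
      have h3 : (s : ℝ) ≤ n := by linarith
      exact_mod_cast h3
    have hcongr : ∀ x, (∃ i, x ∈ e i) → b x = b' x := fun x hx => by simp [hb', hx]
    have hn : n = (n - s) + s := by omega
    have hsupp : ∀ x, b' x ≠ 0 → ∃ i, x ∈ e i := fun x hx => by
      by_contra h
      exact hx (if_neg h)
    rw [hasMatching_congr_support e b b' n (n - s) s hn hbs hcongr,
      hasMatching_iff_covers e he b' hsupp] at h ⊢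
    rcases Nat.eq_zero_or_pos (n - s) with h0 | hpos
    · obtain ⟨c, hc, hcs, hcb⟩ := h
      refine ⟨0, fun _ => le_rfl, by simp [h0], fun x => ?_⟩
      have hc0 : ∀ i, c i = 0 := fun i => by
        rw [h0, Nat.cast_zero] at hcs
        exact (sum_eq_zero_iff_of_nonneg fun i _ => hc i).1 hcs i (mem_univ i)
      have h1 : (b' x : ℝ) ≤ 0 := by simpa [hc0] using hcb x
      have h2 : b' x = 0 := by exact_mod_cast le_antisymm h1 (Nat.cast_nonneg _)
      simp [h2]
    · have hle : ∀ x, b' x ≤ n - s := by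
        intro x
        obtain ⟨c, hc, hcs, hcb⟩ := h
        have h1 : (b' x : ℝ) ≤ (n - s : ℕ) := by
          rw [← hcs]
          refine (hcb x).trans (sum_le_sum fun i _ => ?_)
          exact mul_le_of_le_one_right (hc i) (by exact_mod_cast hv i x)
        exact_mod_cast h1
      have hab : ∀ x, b' x = (n - s) - ((n - s) - b' x) := fun x => by have := hle x; omega
      rw [← packs_compl_iff_covers _ hv _ b' (n - s) hab] at h ⊢
      exact H _ hpos _ h
  · intro H n _ a h
    have hab : ∀ x, (fun x => n - a x) x = n - a x := fun _ => rfl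
    rw [packs_compl_iff_covers _ hv a _ n hab] at h ⊢
    have hsupp : ∀ x, n - a x ≠ 0 → ∃ i, x ∈ e i := fun x hx => by
      by_contra hcon
      obtain ⟨c, hc, hcs, hcb⟩ := h
      have h0 : ∀ i, edgeExponent (e i) x = 0 := fun i => if_neg fun hi => hcon ⟨i, hi⟩
      have h1 : ((n - a x : ℕ) : ℝ) ≤ 0 := by simpa [h0] using hcb x
      exact hx (by exact_mod_cast le_antisymm h1 (Nat.cast_nonneg _))
    rw [← hasMatching_iff_covers e he _ hsupp] at h ⊢
    exact H _ _ h

end Comparison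

/-! ### Powers of monomial ideals -/

/-- The ideal generated by the monomials with exponent vectors `v i`. -/
noncomputable def monomialIdeal (K : Type*) [Field K] {ι V : Type*} [Fintype V] (v : ι → V → ℕ) :
    Ideal (MvPolynomial V K) :=
  Ideal.span (Set.range fun i => MvPolynomial.monomial (Finsupp.equivFunOnFinite.symm (v i)) 1)

theorem monomialIdeal_pow (K : Type*) [Field K] {ι V : Type*} [Fintype ι] [Fintype V]
    (v : ι → V → ℕ) (n : ℕ) :
    monomialIdeal K v ^ n = Ideal.span ((fun s => MvPolynomial.monomial s (1 : K)) ''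
      {s : V →₀ ℕ | ∃ c : ι → ℕ, ∑ i, c i = n ∧ ∀ x, s x = ∑ i, c i * v i x}) := by
  classical
  induction n with
  | zero =>
    rw [pow_zero, Ideal.one_eq_top, eq_comm, Ideal.eq_top_iff_one]
    refine Ideal.subset_span ⟨0, ⟨0, by simp, by simp⟩, by simp⟩
  | succ n ih =>
    rw [pow_succ, ih, monomialIdeal, Ideal.span_mul_span']
    congr 1
    ext f
    rw [Set.mem_mul]
    constructor
    · rintro ⟨_, ⟨s, ⟨c, hc, hs⟩, rfl⟩, _, ⟨j, rfl⟩, rfl⟩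
      refine ⟨s + Finsupp.equivFunOnFinite.symm (v j), ⟨c + Pi.single j 1, ?_, fun x => ?_⟩, ?_⟩
      · simp [sum_add_distrib, hc]
      · simp [add_mul, sum_add_distrib, hs, Pi.single_apply]
      · simp [MvPolynomial.monomial_mul]
    · rintro ⟨s, ⟨c, hc, hs⟩, rfl⟩
      obtain ⟨j, -, hj⟩ : ∃ j ∈ univ, c j ≠ 0 := by
        by_contra! h
        rw [sum_eq_zero h] at hc
        omega
      set c' : ι → ℕ := fun i => c i - (Pi.single j 1 : ι → ℕ) i with hc'
      have hcc : ∀ i, c i = c' i + (Pi.single j 1 : ι → ℕ) i := by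
        intro i
        rcases eq_or_ne i j with rfl | hij
        · simp [hc']; omega
        · simp [hc', hij]
      refine ⟨_, ⟨Finsupp.equivFunOnFinite.symm (fun x => ∑ i, c' i * v i x),
        ⟨c', ?_, fun x => rfl⟩, rfl⟩, _, ⟨j, rfl⟩, ?_⟩
      · simp only [hcc, sum_add_distrib, sum_pi_single', mem_univ, if_true] at hc
        omega
      · simp only [MvPolynomial.monomial_mul, mul_one]
        congr 2
        ext x
        simp [hs, hcc, add_mul, sum_add_distrib, Pi.single_apply]

/-- Membership in a power of a monomial ideal is tested on each term. -/
theorem mem_monomialIdeal_pow {K : Type*} [Field K] {ι V : Type*} [Fintype ι] [Fintype V]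
    (v : ι → V → ℕ) (n : ℕ) (f : MvPolynomial V K) :
    f ∈ monomialIdeal K v ^ n ↔ ∀ a ∈ f.support, Packs ℤ v a n := by
  rw [monomialIdeal_pow, MvPolynomial.mem_ideal_span_monomial_image]
  refine forall₂_congr fun a _ => ?_
  constructor
  · rintro ⟨s, ⟨c, hc, hs⟩, hsa⟩
    refine ⟨fun i => c i, fun i => Nat.cast_nonneg _, by dsimp only; exact_mod_cast hc, fun x => ?_⟩
    have := hsa x
    rw [hs] at this
    dsimp only
    exact_mod_cast this
  · rintro ⟨c, hc, hs, ha⟩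
    lift c to ι → ℕ using hc
    dsimp only at hs ha
    refine ⟨Finsupp.equivFunOnFinite.symm (fun x => ∑ i, c i * v i x),
      ⟨c, by exact_mod_cast hs, fun x => rfl⟩, fun x => ?_⟩
    change ∑ i, c i * v i x ≤ a x
    exact_mod_cast ha x

/-! ### Diophantine approximation and separation -/

/-- Simultaneous Diophantine approximation, by the pigeonhole principle on a compact cube. -/
theorem exists_nat_mul_near_int {ι : Type*} [Fintype ι] (c : ι → ℝ) {ε : ℝ} (hε : 0 < ε) :
    ∃ N : ℕ, 1 ≤ N ∧ ∃ p : ι → ℤ, ∀ i, |(p i : ℝ) - N * c i| < ε := by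
  obtain ⟨y, -, φ, hφ, hy⟩ := (isCompact_Icc (a := (0 : ι → ℝ)) (b := 1)).tendsto_subseq
    (x := fun N i => Int.fract ((N : ℝ) * c i))
    (fun N => ⟨fun i => Int.fract_nonneg _, fun i => (Int.fract_lt_one _).le⟩)
  obtain ⟨k, hk⟩ := Metric.cauchySeq_iff'.1 hy.cauchySeq ε hε
  have h := hk (k + 1) (Nat.le_succ k)
  have hlt := hφ (Nat.lt_succ_self k)
  refine ⟨φ (k + 1) - φ k, by have := hlt; simp at this; omega,
    fun i => ⌊(φ (k + 1) : ℝ) * c i⌋ - ⌊(φ k : ℝ) * c i⌋, fun i => ?_⟩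
  have hi := (dist_pi_lt_iff hε).1 h i
  rw [Real.dist_eq] at hi
  rw [Nat.cast_sub hlt.le, abs_sub_comm]
  convert hi using 2
  simp only [Function.comp, Int.fract]
  push_cast
  ring

/-- A real packing can be scaled and rounded to an integral one: near an integer, a quantity that
violates an integral inequality by less than `1` does not violate it. -/
theorem Packs.exists_int {ι V : Type*} [Fintype ι] [Fintype V] {v : ι → V → ℕ} {a : V → ℕ} {n : ℕ}
    (h : Packs ℝ v a n) : ∃ N : ℕ, 1 ≤ N ∧ Packs ℤ v (fun x => N * a x) (N * n) := by
  obtain ⟨c, hc, hs, ha⟩ := h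
  set M : ℝ := 1 + Fintype.card ι + ∑ i, ∑ x, (v i x : ℝ) with hM
  have hv0 : 0 ≤ ∑ i, ∑ x, (v i x : ℝ) :=
    sum_nonneg fun i _ => sum_nonneg fun x _ => Nat.cast_nonneg _
  have hι0 : (0 : ℝ) ≤ Fintype.card ι := Nat.cast_nonneg _
  have hM0 : 0 < M := by rw [hM]; linarith
  obtain ⟨N, hN, p, hp⟩ := exists_nat_mul_near_int c (one_div_pos.2 hM0)
  have herr : ∀ u : ι → ℝ, (∀ i, 0 ≤ u i) → ∑ i, u i < M →
      |∑ i, ((p i : ℝ) - N * c i) * u i| < 1 := by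
    intro u hu huM
    calc |∑ i, ((p i : ℝ) - N * c i) * u i| ≤ ∑ i, |((p i : ℝ) - N * c i) * u i| :=
          abs_sum_le_sum_abs _ _
      _ ≤ ∑ i, 1 / M * u i := sum_le_sum fun i _ => by
          rw [abs_mul, abs_of_nonneg (hu i)]
          exact mul_le_mul_of_nonneg_right (hp i).le (hu i)
      _ = (∑ i, u i) / M := by rw [← mul_sum]; ring
      _ < 1 := (div_lt_one hM0).2 huM
  refine ⟨N, hN, p, fun i => ?_, ?_, fun x => ?_⟩
  · have h1 := (abs_lt.1 (hp i)).1
    have h2 : 1 / M ≤ 1 := (div_le_one hM0).2 (by rw [hM]; linarith)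
    have h3 : 0 ≤ (N : ℝ) * c i := mul_nonneg (Nat.cast_nonneg _) (hc i)
    have h4 : (-1 : ℝ) < p i := by linarith
    have h5 : (-1 : ℤ) < p i := by exact_mod_cast h4
    omega
  · have h1 := herr (fun _ => 1) (fun _ => zero_le_one) (by simp [hM]; linarith)
    simp only [mul_one, sum_sub_distrib, ← mul_sum, hs] at h1
    have h2 : |∑ i, p i - (N * n : ℤ)| < 1 := by exact_mod_cast h1
    have h3 := Int.abs_lt_one_iff.1 h2
    push_cast
    linarith
  · have h1 := herr (fun i => v i x) (fun _ => Nat.cast_nonneg _) (by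
      have : ∑ i, (v i x : ℝ) ≤ ∑ i, ∑ y, (v i y : ℝ) := sum_le_sum fun i _ =>
        single_le_sum (f := fun y => (v i y : ℝ)) (fun _ _ => Nat.cast_nonneg _) (mem_univ x)
      rw [hM]; linarith)
    simp only [sub_mul, sum_sub_distrib, mul_assoc, ← mul_sum] at h1
    have h2 : (N : ℝ) * ∑ i, c i * (v i x : ℝ) ≤ N * a x :=
      mul_le_mul_of_nonneg_left (ha x) (Nat.cast_nonneg _)
    have h3 : ∑ i, (p i : ℝ) * v i x < N * a x + 1 := by linarith [(abs_lt.1 h1).2]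
    have h4 : ∑ i, p i * (v i x : ℤ) < N * a x + 1 := by exact_mod_cast h3
    push_cast
    linarith

/-- A vector that does not dominate `n` times a convex combination of the `v i` is cut off from all
that do by a linear functional. -/
theorem exists_weight_of_not_packs {ι V : Type*} [Fintype ι] [Fintype V] {v : ι → V → ℕ}
    {a : V → ℕ} {n : ℕ} (h : ¬ Packs ℝ v a n) :
    ∃ (w : V → ℝ) (u : ℝ), ∑ x, a x * w x < u ∧
      ∀ k : ℕ, 1 ≤ k → ∀ b : V → ℕ, Packs ℤ v b (n * k) → k * u < ∑ x, b x * w x := by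
  classical
  set P : Set (ι → ℝ) := {c | (∀ i, 0 ≤ c i) ∧ ∑ i, c i = n} with hP
  set L : (ι → ℝ) →ₗ[ℝ] (V → ℝ) := Fintype.linearCombination ℝ (fun i x => (v i x : ℝ)) with hL
  have hLx : ∀ c x, L c x = ∑ i, c i * v i x := fun c x => by
    simp [hL, Fintype.linearCombination_apply]
  have hPc : IsCompact P := by
    refine (isCompact_Icc (a := (0 : ι → ℝ)) (b := fun _ => n)).of_isClosed_subset ?_ ?_
    · have : P = (⋂ i, {c : ι → ℝ | 0 ≤ c i}) ∩ {c | ∑ i, c i = n} := by ext; simp [hP]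
      rw [this]
      exact (isClosed_iInter fun i => isClosed_le (by fun_prop) (by fun_prop)).inter
        (isClosed_eq (by fun_prop) (by fun_prop))
    · rintro c ⟨hc, hs⟩
      exact ⟨hc, fun i => hs ▸ single_le_sum (fun i _ => hc i) (mem_univ i)⟩
  have hPconv : Convex ℝ P := by
    rintro c ⟨hc, hs⟩ d ⟨hd, ht⟩ α β hα hβ hαβ
    refine ⟨fun i => add_nonneg (mul_nonneg hα (hc i)) (mul_nonneg hβ (hd i)), ?_⟩
    simp [sum_add_distrib, ← mul_sum, hs, ht, ← add_mul, hαβ]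
  have hclosed : IsClosed (L '' P + Set.Ici (0 : V → ℝ)) :=
    isClosed_Ici.add_left_of_isCompact (hPc.image L.continuous_of_finiteDimensional)
  have hconv : Convex ℝ (L '' P + Set.Ici (0 : V → ℝ)) := (hPconv.linear_image L).add (convex_Ici 0)
  have hmem : ∀ y : V → ℝ, y ∈ L '' P + Set.Ici (0 : V → ℝ) ↔ ∃ c : ι → ℝ, (∀ i, 0 ≤ c i) ∧
      ∑ i, c i = n ∧ ∀ x, ∑ i, c i * v i x ≤ y x := by
    intro y
    constructor
    · rintro ⟨_, ⟨c, ⟨hc, hs⟩, rfl⟩, r, hr, rfl⟩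
      refine ⟨c, hc, hs, fun x => ?_⟩
      have := hr x
      simp only [Pi.add_apply, hLx]
      simpa using this
    · rintro ⟨c, hc, hs, hy⟩
      exact ⟨L c, ⟨c, ⟨hc, hs⟩, rfl⟩, y - L c, fun x => by simpa [hLx] using hy x, by simp⟩
  obtain ⟨g, u, hga, hg⟩ := geometric_hahn_banach_point_closed (x := fun x => (a x : ℝ)) hconv
    hclosed (fun hmema => h ((hmem _).1 hmema))
  have hgx : ∀ y, g y = ∑ x, y x * g (Pi.single x 1) := by
    intro y
    conv_lhs => rw [pi_eq_sum_univ' y]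
    simp [map_sum]
  refine ⟨fun x => g (Pi.single x 1), u, by rw [← hgx]; exact hga, ?_⟩
  rintro k hk b ⟨c, hc, hs, hb⟩
  have hk0 : (0 : ℝ) < k := by exact_mod_cast hk
  have h1 := hg (fun x => (b x : ℝ) / k) ((hmem _).2 ⟨fun i => (c i : ℝ) / k,
    fun i => div_nonneg (by exact_mod_cast hc i) hk0.le, ?_, fun x => ?_⟩)
  · rw [hgx] at h1
    simp only [div_mul_eq_mul_div, ← sum_div] at h1
    rw [lt_div_iff₀ hk0] at h1
    linarith
  · rw [← sum_div, div_eq_iff hk0.ne']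
    exact_mod_cast hs
  · simp only [div_mul_eq_mul_div, ← sum_div]
    exact div_le_div_of_nonneg_right (by exact_mod_cast hb x) hk0.le

/-! ### Weights and integral dependence -/

section Weight

variable {K V : Type*} [Field K] (w : V → ℝ)

open MvPolynomial

theorem le_weight_mul {f g : MvPolynomial V K} {s t : ℝ}
    (hf : ∀ b ∈ f.support, s ≤ Finsupp.weight w b) (hg : ∀ b ∈ g.support, t ≤ Finsupp.weight w b) :
    ∀ b ∈ (f * g).support, s + t ≤ Finsupp.weight w b := by
  classical
  intro b hb
  obtain ⟨x, hx, y, hy, rfl⟩ := Finset.mem_add.1 (support_mul f g hb)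
  rw [map_add]
  exact add_le_add (hf x hx) (hg y hy)

theorem lt_weight_mul {f g : MvPolynomial V K} {s t : ℝ}
    (hf : ∀ b ∈ f.support, s ≤ Finsupp.weight w b) (hg : ∀ b ∈ g.support, t < Finsupp.weight w b) :
    ∀ b ∈ (f * g).support, s + t < Finsupp.weight w b := by
  classical
  intro b hb
  obtain ⟨x, hx, y, hy, rfl⟩ := Finset.mem_add.1 (support_mul f g hb)
  rw [map_add]
  exact add_lt_add_of_le_of_lt (hf x hx) (hg y hy)

theorem lt_weight_add {f g : MvPolynomial V K} {t : ℝ}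
    (hf : ∀ b ∈ f.support, t < Finsupp.weight w b) (hg : ∀ b ∈ g.support, t < Finsupp.weight w b) :
    ∀ b ∈ (f + g).support, t < Finsupp.weight w b := by
  classical
  intro b hb
  rcases Finset.mem_union.1 (support_add hb) with h | h
  exacts [hf b h, hg b h]

theorem lt_weight_sum {α : Type*} (S : Finset α) {f : α → MvPolynomial V K} {t : ℝ}
    (hf : ∀ i ∈ S, ∀ b ∈ (f i).support, t < Finsupp.weight w b) :
    ∀ b ∈ (∑ i ∈ S, f i).support, t < Finsupp.weight w b := by
  classical
  intro b hb
  obtain ⟨i, hi, h⟩ := Finset.mem_biUnion.1 (support_sum hb)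
  exact hf i hi b h

theorem le_weight_pow {f : MvPolynomial V K} {s : ℝ}
    (hf : ∀ b ∈ f.support, s ≤ Finsupp.weight w b) (m : ℕ) :
    ∀ b ∈ (f ^ m).support, m * s ≤ Finsupp.weight w b := by
  classical
  induction m with
  | zero =>
    intro b hb
    rw [pow_zero, mem_support_iff, coeff_one] at hb
    have : (0 : V →₀ ℕ) = b := by by_contra h; simp [h] at hb
    simp [← this]
  | succ m ih =>
    intro b hb
    rw [pow_succ] at hb
    have := le_weight_mul w ih hf b hb
    push_cast
    linarith

/-- The lowest homogeneous part of `f` has as its `m`-th power the lowest homogeneous part of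
`f ^ m`. -/
theorem lt_weight_pow_sub_pow {f f₀ : MvPolynomial V K} {s : ℝ}
    (hf : ∀ b ∈ f.support, s ≤ Finsupp.weight w b)
    (hf₀ : ∀ b ∈ f₀.support, s ≤ Finsupp.weight w b)
    (h : ∀ b ∈ (f - f₀).support, s < Finsupp.weight w b) (m : ℕ) :
    ∀ b ∈ (f ^ m - f₀ ^ m).support, m * s < Finsupp.weight w b := by
  induction m with
  | zero => simp
  | succ m ih =>
    have h1 : f ^ (m + 1) - f₀ ^ (m + 1) = f ^ m * (f - f₀) + f₀ * (f ^ m - f₀ ^ m) := by ring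
    have h2 : ((m + 1 : ℕ) : ℝ) * s = m * s + s := by push_cast; ring
    rw [h1, h2]
    refine lt_weight_add w (lt_weight_mul w (le_weight_pow w hf m) h) ?_
    rw [add_comm (m * s : ℝ)]
    exact lt_weight_mul w hf₀ ih

/-- Compare the terms of least weight in an equation of integral dependence: if `f` has a term of
weight less than `u` and all terms of the `i`-th coefficient have weight greater than `i * u`, the
`m`-th power of the lowest homogeneous part of `f` cannot be cancelled. -/
theorem integral_equation_false_of_weight {f : MvPolynomial V K} {a : V →₀ ℕ} (ha : a ∈ f.support)
    {u : ℝ} (hau : Finsupp.weight w a < u) (m : ℕ) (c : ℕ → MvPolynomial V K)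
    (hc : ∀ i ∈ Icc 1 m, ∀ b ∈ (c i).support, i * u < Finsupp.weight w b)
    (h : f ^ m + ∑ i ∈ Icc 1 m, c i * f ^ (m - i) = 0) : False := by
  classical
  obtain ⟨a₀, ha₀, hmin⟩ := f.support.exists_min_image (Finsupp.weight w) ⟨a, ha⟩
  set s := Finsupp.weight w a₀ with hs
  have hsu : s < u := (hmin a ha).trans_lt hau
  set f₀ := weightedHomogeneousComponent w s f with hf₀
  have hhom : IsWeightedHomogeneous w f₀ s :=
    weightedHomogeneousComponent_isWeightedHomogeneous s f
  have hne : f₀ ≠ 0 := by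
    intro h0
    have := congrArg (coeff a₀) h0
    rw [hf₀, coeff_weightedHomogeneousComponent, if_pos hs.symm, coeff_zero] at this
    exact mem_support_iff.1 ha₀ this
  have hsub : ∀ b ∈ (f - f₀).support, s < Finsupp.weight w b := by
    intro b hb
    rw [mem_support_iff, coeff_sub, hf₀, coeff_weightedHomogeneousComponent] at hb
    split_ifs at hb with hbs
    · simp at hb
    · exact lt_of_le_of_ne (hmin b (mem_support_iff.2 (by simpa using hb))) (Ne.symm hbs)
  have hlow : ∀ b ∈ f₀.support, s ≤ Finsupp.weight w b := fun b hb =>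
    (hhom (mem_support_iff.1 hb)).ge
  have h1 := lt_weight_pow_sub_pow w hmin hlow hsub m
  have h2 : ∀ b ∈ (∑ i ∈ Icc 1 m, c i * f ^ (m - i)).support, m * s < Finsupp.weight w b := by
    refine lt_weight_sum w _ fun i hi => ?_
    have him := Finset.mem_Icc.1 hi
    have h3 : (m : ℝ) * s = ((m - i : ℕ) : ℝ) * s + i * s := by
      rw [Nat.cast_sub him.2]; ring
    rw [mul_comm, h3]
    refine lt_weight_mul w (le_weight_pow w hmin _) fun b hb => ?_
    exact (mul_le_mul_of_nonneg_left hsu.le (Nat.cast_nonneg i)).trans_lt (hc i hi b hb)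
  have h3 : -f₀ ^ m = (f ^ m - f₀ ^ m) + ∑ i ∈ Icc 1 m, c i * f ^ (m - i) := by
    linear_combination -h
  have h4 := lt_weight_add w h1 h2
  rw [← h3] at h4
  obtain ⟨b, hb⟩ := support_nonempty.2 (pow_ne_zero m hne)
  have h5 := hhom.pow m (mem_support_iff.1 hb)
  have h6 := h4 b (by rwa [support_neg])
  rw [h5, nsmul_eq_mul] at h6
  exact lt_irrefl _ h6

end Weight

/-! ### The normality criterion -/

/-- A monomial ideal is normal exactly if its generators have the integer rounding property. -/
theorem isNormalIdeal_monomialIdeal_iff (K : Type*) [Field K] {ι V : Type*} [Fintype ι] [Fintype V]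
    (v : ι → V → ℕ) :
    IsNormalIdeal (monomialIdeal K v) ↔
      ∀ n : ℕ, 1 ≤ n → ∀ a : V → ℕ, Packs ℝ v a n → Packs ℤ v a n := by
  classical
  refine forall₂_congr fun n hn => ?_
  constructor
  · intro H a ha
    obtain ⟨N, hN, hp⟩ := ha.exists_int
    set s : V →₀ ℕ := Finsupp.equivFunOnFinite.symm a
    have hmem : (MvPolynomial.monomial s (1 : K)) ∈
        idealIntegralClosure (monomialIdeal K v ^ n) := by
      -- The equation of integral dependence is `x ^ N - x ^ N = 0`.
      refine ⟨N, hN, fun i => if i = N then -(MvPolynomial.monomial s (1 : K)) ^ N else 0, ?_, ?_⟩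
      · intro i _
        dsimp only
        split_ifs with h
        · subst h
          rw [neg_mem_iff, ← pow_mul, mem_monomialIdeal_pow]
          intro b hb
          rw [MvPolynomial.monomial_pow] at hb
          rw [Finset.mem_singleton.1 (MvPolynomial.support_monomial_subset hb), mul_comm]
          exact hp
        · exact zero_mem _
      · rw [sum_eq_single_of_mem N (by simp [hN])]
        · simp
        · intro i _ hi
          simp [hi]
    rw [H, SetLike.mem_coe, mem_monomialIdeal_pow] at hmem
    exact hmem s (by simp [MvPolynomial.mem_support_iff])
  · intro H
    refine Set.Subset.antisymm ?_ fun f hf => ?_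
    · rintro f ⟨m, -, c, hc, h⟩
      rw [SetLike.mem_coe, mem_monomialIdeal_pow]
      intro a ha
      refine H a ?_
      by_contra hna
      obtain ⟨w, u, hau, hw⟩ := exists_weight_of_not_packs hna
      have hweight : ∀ b : V →₀ ℕ, Finsupp.weight w b = ∑ x, b x * w x := fun b => by
        rw [Finsupp.weight_apply, Finsupp.sum_fintype _ _ (by simp)]
        simp
      refine integral_equation_false_of_weight w ha (u := u) (by rwa [hweight]) m c
        (fun i hi b hb => ?_) h
      have hci := hc i hi
      rw [← pow_mul, mem_monomialIdeal_pow] at hci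
      rw [hweight]
      exact hw i (Finset.mem_Icc.1 hi).1 b (hci b hb)
    · exact ⟨1, le_rfl, fun _ => -f, by simpa using hf, by simp⟩

/-! ### The Hilbert basis -/

/-- The vector `(b, n)` of `ℝ^(s+1)`; the last coordinate has the index `none`. -/
def latticePoint {V : Type*} (b : V → ℕ) (n : ℕ) : Option V → ℝ :=
  fun o => o.elim (n : ℝ) (fun x => (b x : ℝ))

open scoped Classical in
/-- The family underlying `graphVectors`. -/
noncomputable def graphVector {V : Type*} (G : SimpleGraph V) :
    Option (V ⊕ G.edgeSet) → Option V → ℝ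
  | none => appendOne 0
  | some (Sum.inl i) => appendOne (Pi.single i 1)
  | some (Sum.inr e) => appendOne (edgeVector e.1)

theorem range_graphVector {V : Type*} (G : SimpleGraph V) :
    Set.range (graphVector G) = graphVectors G := by
  classical
  ext y
  simp only [Set.mem_range, Option.exists, Sum.exists, graphVector, graphVectors, Set.mem_union,
    Set.mem_singleton_iff, Set.mem_image, Subtype.exists, exists_prop, or_assoc, eq_comm (a := y)]

theorem edgeVector_apply {V : Type*} (e : Sym2 V) (x : V) :
    edgeVector e x = (edgeExponent e x : ℝ) := by
  classical
  by_cases h : x ∈ e <;> simp [edgeVector, edgeExponent, h]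

section

variable {V : Type*} [Fintype V] (G : SimpleGraph V) [Fintype G.edgeSet]

theorem sum_mul_graphVector_none (c : Option (V ⊕ G.edgeSet) → ℝ) :
    ∑ k, c k * graphVector G k none = ∑ k, c k := by
  refine sum_congr rfl fun k _ => ?_
  rcases k with _ | _ | _ <;> simp [graphVector, appendOne]

theorem sum_mul_graphVector_some (c : Option (V ⊕ G.edgeSet) → ℝ) (x : V) :
    ∑ k, c k * graphVector G k (some x) =
      c (some (Sum.inl x)) + ∑ e : G.edgeSet, c (some (Sum.inr e)) * edgeExponent e.1 x := by
  classical
  simp [Fintype.sum_option, graphVector, appendOne, edgeVector_apply, Pi.single_apply]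

/-- The slack of a matching is taken up by the coefficients of the vectors `e_i + e_{s+1}` and
`e_{s+1}`. -/
theorem hasMatching_iff_exists_coeff {R : Type*} [CommRing R] [LinearOrder R]
    [IsStrictOrderedRing R] (b : V → ℕ) (n : ℕ) :
    HasMatching R (fun e : G.edgeSet => edgeExponent e.1) b n ↔
      ∃ c : Option (V ⊕ G.edgeSet) → R, (∀ k, 0 ≤ c k) ∧ ∑ k, c k = n ∧
        ∀ x, c (some (Sum.inl x)) + ∑ e : G.edgeSet, c (some (Sum.inr e)) * edgeExponent e.1 x
          = b x := by
  have hsum := sum_sum_mul_edgeExponent (R := R) (fun e : G.edgeSet => e.1)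
    (fun e => G.not_isDiag_of_mem_edgeSet e.2)
  constructor
  · rintro ⟨d, hd, hdb, hs⟩
    refine ⟨fun k => k.elim (n + ∑ e, d e - ∑ x, (b x : R))
      (Sum.elim (fun x => b x - ∑ e, d e * edgeExponent e.1 x) d), ?_, ?_, fun x => ?_⟩
    · rintro (_ | x | e)
      · exact sub_nonneg.2 hs
      · exact sub_nonneg.2 (hdb x)
      · exact hd e
    · simp only [Fintype.sum_option, Fintype.sum_sum_type, Option.elim_none, Option.elim_some,
        Sum.elim_inl, Sum.elim_inr, sum_sub_distrib, hsum d]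
      ring
    · simp
  · rintro ⟨c, hc, hs, hb⟩
    refine ⟨fun e => c (some (Sum.inr e)), fun e => hc _, fun x => ?_, ?_⟩
    · rw [← hb x]
      exact le_add_of_nonneg_left (hc _)
    · have h1 : ∑ x, (b x : R) = ∑ x, c (some (Sum.inl x)) + 2 * ∑ e, c (some (Sum.inr e)) := by
        rw [← hsum, ← sum_add_distrib]
        exact sum_congr rfl fun x _ => (hb x).symm
      simp only [Fintype.sum_option, Fintype.sum_sum_type] at hs
      have := hc none
      rw [h1, ← hs]
      linarith

theorem mem_hull_graphVectors_iff (y : Option V → ℝ) :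
    y ∈ PointedCone.hull ℝ (graphVectors G) ↔
      ∃ c : Option (V ⊕ G.edgeSet) → ℝ, (∀ k, 0 ≤ c k) ∧
        ∀ o, ∑ k, c k * graphVector G k o = y o := by
  rw [← range_graphVector, PointedCone.hull, Submodule.mem_span_range_iff_exists_fun]
  constructor
  · rintro ⟨c, rfl⟩
    refine ⟨fun k => c k, fun k => (c k).2, fun o => ?_⟩
    rw [Finset.sum_apply]
    rfl
  · rintro ⟨c, hc, h⟩
    refine ⟨fun k => ⟨c k, hc k⟩, funext fun o => ?_⟩
    rw [← h, Finset.sum_apply]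
    rfl

theorem mem_closure_graphVectors_iff (y : Option V → ℝ) :
    y ∈ AddSubmonoid.closure (graphVectors G) ↔
      ∃ c : Option (V ⊕ G.edgeSet) → ℕ, ∀ o, ∑ k, (c k : ℝ) * graphVector G k o = y o := by
  rw [← range_graphVector, ← Submodule.span_nat_eq_addSubmonoidClosure,
    Submodule.mem_toAddSubmonoid, Submodule.mem_span_range_iff_exists_fun]
  refine exists_congr fun c => funext_iff.trans (forall_congr' fun o => ?_)
  simp [Finset.sum_apply]

theorem latticePoint_mem_hull_iff (b : V → ℕ) (n : ℕ) :
    latticePoint b n ∈ PointedCone.hull ℝ (graphVectors G) ↔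
      HasMatching ℝ (fun e : G.edgeSet => edgeExponent e.1) b n := by
  rw [mem_hull_graphVectors_iff, hasMatching_iff_exists_coeff]
  simp only [Option.forall, sum_mul_graphVector_none, sum_mul_graphVector_some, latticePoint,
    Option.elim_none, Option.elim_some]

theorem latticePoint_mem_closure_iff (b : V → ℕ) (n : ℕ) :
    latticePoint b n ∈ AddSubmonoid.closure (graphVectors G) ↔
      HasMatching ℤ (fun e : G.edgeSet => edgeExponent e.1) b n := by
  rw [mem_closure_graphVectors_iff, hasMatching_iff_exists_coeff]
  simp only [Option.forall, sum_mul_graphVector_none, sum_mul_graphVector_some, latticePoint,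
    Option.elim_none, Option.elim_some]
  constructor
  · rintro ⟨c, hs, hb⟩
    refine ⟨fun k => c k, ⟨Nat.cast_nonneg _, fun _ => Nat.cast_nonneg _⟩, ?_, fun x => ?_⟩
    · dsimp only
      exact_mod_cast hs
    · dsimp only
      exact_mod_cast hb x
  · rintro ⟨c, ⟨h0, hc⟩, hs, hb⟩
    have hc' : ∀ k, 0 ≤ c k := Option.forall.2 ⟨h0, hc⟩
    lift c to Option (V ⊕ G.edgeSet) → ℕ using hc'
    dsimp only at hs hb
    exact ⟨c, by exact_mod_cast hs, fun x => by exact_mod_cast hb x⟩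

/-- The cone and the semigroup generated by `graphVectors G` consist of the `(b, n)` for which a
fractional, respectively an integral, `b`-matching of size at least `|b| - n` exists. -/
theorem isHilbertBasisSet_graphVectors_iff :
    IsHilbertBasisSet (graphVectors G) ↔
      ∀ (b : V → ℕ) (n : ℕ), HasMatching ℝ (fun e : G.edgeSet => edgeExponent e.1) b n →
        HasMatching ℤ (fun e : G.edgeSet => edgeExponent e.1) b n := by
  have hfin : (graphVectors G).Finite := range_graphVector G ▸ Set.finite_range _
  simp only [← latticePoint_mem_hull_iff, ← latticePoint_mem_closure_iff]
  constructor
  · rintro ⟨-, h⟩ b n hbn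
    refine (Set.ext_iff.1 h _).1 ⟨?_, hbn⟩
    rintro (_ | x)
    exacts [⟨n, rfl⟩, ⟨b x, rfl⟩]
  · refine fun H => ⟨hfin, Set.Subset.antisymm ?_ ?_⟩
    · rintro y ⟨hint, hy⟩
      have hnonneg : ∀ o, 0 ≤ y o := by
        obtain ⟨c, hc, h⟩ := (mem_hull_graphVectors_iff G y).1 hy
        rintro (_ | x)
        · rw [← h, sum_mul_graphVector_none]
          exact sum_nonneg fun k _ => hc k
        · rw [← h, sum_mul_graphVector_some]
          exact add_nonneg (hc _)
            (sum_nonneg fun e _ => mul_nonneg (hc _) (Nat.cast_nonneg _))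
      choose z hz using hint
      have hz0 : ∀ o, 0 ≤ z o := fun o => by
        have := hnonneg o
        rw [hz] at this
        exact_mod_cast this
      lift z to Option V → ℕ using hz0
      have hyz : y = latticePoint (fun x => z (some x)) (z none) := by
        funext o
        rcases o with _ | x <;> simp [latticePoint, hz]
      rw [hyz] at hy ⊢
      exact H _ _ hy
    · intro y hy
      obtain ⟨c, h⟩ := (mem_closure_graphVectors_iff G y).1 hy
      refine ⟨?_, (mem_hull_graphVectors_iff G y).2 ⟨fun k => c k, fun k => Nat.cast_nonneg _, h⟩⟩
      rintro (_ | x)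
      · rw [← h, sum_mul_graphVector_none]
        exact ⟨∑ k, (c k : ℤ), by push_cast; rfl⟩
      · rw [← h, sum_mul_graphVector_some]
        exact ⟨c (some (Sum.inl x)) + ∑ e : G.edgeSet,
          (c (some (Sum.inr e)) : ℤ) * edgeExponent e.1 x, by push_cast; rfl⟩

end

/-! ### The edge ideal and its dual as monomial ideals -/

theorem edgeMonomial_eq (K : Type*) [Field K] {V : Type*} [Fintype V] (e : Sym2 V) :
    edgeMonomial K e =
      MvPolynomial.monomial (Finsupp.equivFunOnFinite.symm (edgeExponent e)) 1 := by
  classical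
  rw [MvPolynomial.monomial_eq, Finsupp.prod_fintype _ _ (by simp), map_one, one_mul, edgeMonomial,
    prod_filter]
  refine prod_congr rfl fun x _ => ?_
  by_cases h : x ∈ e <;> simp [edgeExponent, h]

theorem coedgeMonomial_eq (K : Type*) [Field K] {V : Type*} [Fintype V] (e : Sym2 V) :
    coedgeMonomial K e =
      MvPolynomial.monomial (Finsupp.equivFunOnFinite.symm (fun x => 1 - edgeExponent e x)) 1 := by
  classical
  rw [MvPolynomial.monomial_eq, Finsupp.prod_fintype _ _ (by simp), map_one, one_mul,
    coedgeMonomial, prod_filter]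
  refine prod_congr rfl fun x _ => ?_
  by_cases h : x ∈ e <;> simp [edgeExponent, h]

theorem edgeIdeal_eq (K : Type*) [Field K] {V : Type*} [Fintype V]
    (G : SimpleGraph V) :
    edgeIdeal K G = monomialIdeal K (fun e : G.edgeSet => edgeExponent e.1) := by
  rw [edgeIdeal, monomialIdeal]
  congr 1
  ext f
  simp [edgeMonomial_eq, eq_comm]

theorem dualEdgeIdeal_eq (K : Type*) [Field K] {V : Type*} [Fintype V]
    (G : SimpleGraph V) :
    dualEdgeIdeal K G = monomialIdeal K (fun (e : G.edgeSet) x => 1 - edgeExponent e.1 x) := by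
  rw [dualEdgeIdeal, monomialIdeal]
  congr 1
  ext f
  simp [coedgeMonomial_eq, eq_comm]

end EdgeIdealDuality

theorem mainTheorem4 {K : Type*} [Field K] {V : Type*} [Fintype V] (G : SimpleGraph V) :
    (EdgeIdealDuality.IsNormalIdeal (EdgeIdealDuality.dualEdgeIdeal K G) ↔
      EdgeIdealDuality.IsNormalIdeal (EdgeIdealDuality.edgeIdeal K G)) ∧
    (EdgeIdealDuality.IsNormalIdeal (EdgeIdealDuality.dualEdgeIdeal K G) ↔
      EdgeIdealDuality.IsHilbertBasisSet (EdgeIdealDuality.graphVectors G)) := by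
  classical
  have : Fintype G.edgeSet := Fintype.ofFinite _
  have he : ∀ e : G.edgeSet, ¬ e.1.IsDiag := fun e => G.not_isDiag_of_mem_edgeSet e.2
  rw [EdgeIdealDuality.edgeIdeal_eq, EdgeIdealDuality.dualEdgeIdeal_eq,
    EdgeIdealDuality.isNormalIdeal_monomialIdeal_iff,
    EdgeIdealDuality.isNormalIdeal_monomialIdeal_iff,
    EdgeIdealDuality.packs_compl_int_iff_matching_int (fun e : G.edgeSet => e.1) he,
    EdgeIdealDuality.packs_int_iff_matching_int (fun e : G.edgeSet => e.1) he,
    EdgeIdealDuality.isHilbertBasisSet_graphVectors_iff]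
  exact ⟨Iff.rfl, Iff.rfl⟩
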